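/- Let $\mathcal A$ be any set of actions, let $\tau\notin\mathcal A$ and $\mathcal A_\tau=\mathcal A\cup\{\tau\}$. Process expressions are generated by $$P ::= \mathbf 0 \mid \alpha.P \mid P+P \mid P\parallel P \mid \alpha^{*}P\qquad(\alpha\in\mathcal A_\tau),$$ and their transitions $P\xrightarrow{\alpha}P'$ are the least relations such that: $\alpha.P\xrightarrow{\alpha}P$; if $P\xrightarrow{\alpha}P'$ then $P+Q\xrightarrow{\alpha}P'$, $Q+P\xrightarrow{\alpha}P'$, $P\parallel Q\xrightarrow{\alpha}P'\parallel Q$ and $Q\parallel P\xrightarrow{\alpha}Q\parallel P'$; $\alpha^{*}P\xrightarrow{\alpha}\alpha^{*}P$; and if $P\xrightarrow{\beta}P'$ then $\alpha^{*}P\xrightarrow{\beta}P'$. Write $\Rightarrow$ for the reflexive-transitive closure of $\xrightarrow{\tau}$, and $P\xrightarrow{(\alpha)}P'$ if $P\xrightarrow{\alpha}P'$, or $\alpha=\tau$ and $P=P'$. A symmetric relation $\mathcal R$ on process expressions is a branching bisimulation if, whenever $P\mathrel{\mathcal R}Q$ and $P\xrightarrow{\alpha}P'$, there are $Q'',Q'$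 with $Q\Rightarrow Q''\xrightarrow{(\alpha)}Q'$, $P\mathrel{\mathcal R}Q''$ and $P'\mathrel{\mathcal R}Q'$. It is a weak bisimulation if, whenever $P\mathrel{\mathcal R}Q$ and $P\xrightarrow{\alpha}P'$, there are $Q'',Q''',Q'$ with $Q\Rightarrow Q''\xrightarrow{(\alpha)}Q'''\Rightarrow Q'$ and $P'\mathrel{\mathcal R}Q'$. Two process expressions are branching (weakly) bisimilar if some branching (weak) bisimulation relates them. Both bisimilarities are equivalence relations compatible with $\parallel$, and the quotients of the set of process expressions by them are commutative monoids under $[P]\parallel[Q]=[P\parallel Q]$, with identity element $[\mathbf 0]$. A process expression $P$ is weakly bounded if there is $k\in\mathbb N$ such that $\ell\le k$ whenever there are $a_1,\dots,a_\ell\in\mathcal A$ and $P_0=P,P_1,\dots,P_\ell$ with $P_{i-1}\Rightarrow\xrightarrow{a_i}\Rightarrow P_i$ for $1\le i\le\ell$. Let $\mathbf B_{\mathrm{fin}}$ and $\mathbf W_{\mathrm{fin}}$ be the sets of branching, respectively weak, bisimilarity classes of weakly bounded process expressions; they are commutative submonoids of the two monoids above. An element $p$ of a commutative monoid is indecomposable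 if it is not the identity and $p=xy$ implies that $x$ or $y$ is the identity. A decomposition of an element $x$ is a finite (possibly empty) multiset of indecomposables whose product is $x$. A commutative monoid has unique decomposition if each of its elements has exactly one decomposition. **Theorem.** The commutative monoids $\mathbf B_{\mathrm{fin}}$ and $\mathbf W_{\mathrm{fin}}$ both have unique decomposition. -/

import Mathlib

namespace BCCS

universe u

/-- Transition labels: the silent action `τ` and the visible actions in `Act`. -/
inductive Label (Act : Type u) : Type u
  | tau : Label Act
  | act : Act → Label Act

/-- Process expressions: `0`, `α.P`, `P + Q`, `P ∥ Q` and the prefix iteration `α*P`. -/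
inductive Proc (Act : Type u) : Type u
  | nil : Proc Act
  | pref : Label Act → Proc Act → Proc Act
  | alt : Proc Act → Proc Act → Proc Act
  | par : Proc Act → Proc Act → Proc Act
  | star : Label Act → Proc Act → Proc Act

/-- The operational semantics: `Step P α P'` is the transition `P —α→ P'`. -/
inductive Step {Act : Type u} : Proc Act → Label Act → Proc Act → Prop
  | pref (α : Label Act) (P : Proc Act) : Step (Proc.pref α P) α P
  | altL {P P' : Proc Act} {α : Label Act} (Q : Proc Act) :
      Step P α P' → Step (Proc.alt P Q) α P'
  | altR {Q Q' : Proc Act} {α : Label Act} (P : Proc Act) :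
      Step Q α Q' → Step (Proc.alt P Q) α Q'
  | parL {P P' : Proc Act} {α : Label Act} (Q : Proc Act) :
      Step P α P' → Step (Proc.par P Q) α (Proc.par P' Q)
  | parR {Q Q' : Proc Act} {α : Label Act} (P : Proc Act) :
      Step Q α Q' → Step (Proc.par P Q) α (Proc.par P Q')
  | starLoop (α : Label Act) (P : Proc Act) : Step (Proc.star α P) α (Proc.star α P)
  | starExit {P P' : Proc Act} {β : Label Act} (α : Label Act) :
      Step P β P' → Step (Proc.star α P) β P'

variable {Act : Type u}

/-- `P` evolves into `P'` by finitely many (possibly zero) `τ`-transitions. -/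
def SilentSteps : Proc Act → Proc Act → Prop :=
  Relation.ReflTransGen (fun P P' => Step P Label.tau P')

/-- `P —α→ P'`, or `α = τ` and `P = P'`. -/
def OptStep (P : Proc Act) (α : Label Act) (P' : Proc Act) : Prop :=
  Step P α P' ∨ (α = Label.tau ∧ P = P')

/-! ### Branching and weak bisimilarity -/

/-- `R` is a branching bisimulation. -/
def IsBranchingBisimulation (R : Proc Act → Proc Act → Prop) : Prop :=
  (∀ P Q, R P Q → R Q P) ∧
  ∀ P Q, R P Q → ∀ (α : Label Act) (P' : Proc Act), Step P α P' →
    ∃ Q'' Q', SilentSteps Q Q'' ∧ OptStep Q'' α Q' ∧ R P Q'' ∧ R P' Q'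

/-- Branching bisimilarity. -/
def BBisim (P Q : Proc Act) : Prop :=
  ∃ R : Proc Act → Proc Act → Prop, IsBranchingBisimulation R ∧ R P Q

/-- `R` is a weak bisimulation. -/
def IsWeakBisimulation (R : Proc Act → Proc Act → Prop) : Prop :=
  (∀ P Q, R P Q → R Q P) ∧
  ∀ P Q, R P Q → ∀ (α : Label Act) (P' : Proc Act), Step P α P' →
    ∃ Q'' Q''' Q', SilentSteps Q Q'' ∧ OptStep Q'' α Q''' ∧ SilentSteps Q''' Q' ∧ R P' Q'

/-- Weak bisimilarity. -/
def WBisim (P Q : Proc Act) : Prop :=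
  ∃ R : Proc Act → Proc Act → Prop, IsWeakBisimulation R ∧ R P Q

/-! ### Weakly bounded process expressions -/

/-- `P ⇒ —a→ ⇒ P'` for a visible action `a`. -/
def WeakStep (P : Proc Act) (a : Act) (P' : Proc Act) : Prop :=
  ∃ S S', SilentSteps P S ∧ Step S (Label.act a) S' ∧ SilentSteps S' P'

/-- A sequence of weak visible transitions, labelled by the list, from the first process
expression to the second. -/
def WeakRun : Proc Act → List Act → Proc Act → Prop
  | P, [], P' => P = P'
  | P, a :: w, P' => ∃ S, WeakStep P a S ∧ WeakRun S w P'

/-- `P` is weakly bounded by `k`. -/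
def WeaklyBoundedBy (k : ℕ) (P : Proc Act) : Prop :=
  ∀ (w : List Act) (P' : Proc Act), WeakRun P w P' → w.length ≤ k

/-- `P` is weakly bounded. -/
def WeaklyBounded (P : Proc Act) : Prop := ∃ k : ℕ, WeaklyBoundedBy k P

/-! ### Facts needed to form the quotient monoids -/

theorem SilentSteps.parL {P P' : Proc Act} (Q : Proc Act) (h : SilentSteps P P') :
    SilentSteps (Proc.par P Q) (Proc.par P' Q) := by
  induction h with
  | refl => exact Relation.ReflTransGen.refl
  | tail _ s ih => exact Relation.ReflTransGen.tail ih (Step.parL Q s)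

theorem SilentSteps.parR {Q Q' : Proc Act} (P : Proc Act) (h : SilentSteps Q Q') :
    SilentSteps (Proc.par P Q) (Proc.par P Q') := by
  induction h with
  | refl => exact Relation.ReflTransGen.refl
  | tail _ s ih => exact Relation.ReflTransGen.tail ih (Step.parR P s)

theorem OptStep.parL {P P' : Proc Act} {α : Label Act} (Q : Proc Act) (h : OptStep P α P') :
    OptStep (Proc.par P Q) α (Proc.par P' Q) := by
  rcases h with h | ⟨rfl, rfl⟩
  · exact Or.inl (Step.parL Q h)
  · exact Or.inr ⟨rfl, rfl⟩

theorem OptStep.parR {Q Q' : Proc Act} {α : Label Act} (P : Proc Act) (h : OptStep Q α Q') :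
    OptStep (Proc.par P Q) α (Proc.par P Q') := by
  rcases h with h | ⟨rfl, rfl⟩
  · exact Or.inl (Step.parR P h)
  · exact Or.inr ⟨rfl, rfl⟩

theorem OptStep.silentSteps {P P' : Proc Act} (h : OptStep P Label.tau P') :
    SilentSteps P P' := by
  rcases h with h | ⟨-, rfl⟩
  · exact Relation.ReflTransGen.single h
  · exact Relation.ReflTransGen.refl

theorem IsBranchingBisimulation.isWeak {R : Proc Act → Proc Act → Prop}
    (h : IsBranchingBisimulation R) : IsWeakBisimulation R := by
  refine ⟨h.1, fun P Q hPQ α P' s => ?_⟩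
  obtain ⟨Q'', Q', h1, h2, -, h4⟩ := h.2 P Q hPQ α P' s
  exact ⟨Q'', Q', Q', h1, h2, Relation.ReflTransGen.refl, h4⟩

theorem BBisim.wbisim {P Q : Proc Act} (h : BBisim P Q) : WBisim P Q := by
  obtain ⟨R, hR, h⟩ := h
  exact ⟨R, hR.isWeak, h⟩

theorem isBranchingBisimulation_bbisim :
    IsBranchingBisimulation (BBisim : Proc Act → Proc Act → Prop) := by
  refine ⟨?_, ?_⟩
  · rintro P Q ⟨R, hR, h⟩
    exact ⟨R, hR, hR.1 _ _ h⟩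
  · rintro P Q ⟨R, hR, h⟩ α P' s
    obtain ⟨Q'', Q', h1, h2, h3, h4⟩ := hR.2 P Q h α P' s
    exact ⟨Q'', Q', h1, h2, ⟨R, hR, h3⟩, ⟨R, hR, h4⟩⟩

theorem isWeakBisimulation_wbisim :
    IsWeakBisimulation (WBisim : Proc Act → Proc Act → Prop) := by
  refine ⟨?_, ?_⟩
  · rintro P Q ⟨R, hR, h⟩
    exact ⟨R, hR, hR.1 _ _ h⟩
  · rintro P Q ⟨R, hR, h⟩ α P' s
    obtain ⟨Q'', Q''', Q', h1, h2, h3, h4⟩ := hR.2 P Q h α P' s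
    exact ⟨Q'', Q''', Q', h1, h2, h3, ⟨R, hR, h4⟩⟩

/-- A symmetric relation that matches every step by a single step with the same label is
contained in branching bisimilarity. -/
theorem bbisim_of_strong {R : Proc Act → Proc Act → Prop} (hs : ∀ P Q, R P Q → R Q P)
    (hstep : ∀ P Q, R P Q → ∀ (α : Label Act) (P' : Proc Act), Step P α P' →
      ∃ Q', Step Q α Q' ∧ R P' Q') {P Q : Proc Act} (h : R P Q) : BBisim P Q := by
  refine ⟨R, ⟨hs, fun P Q hPQ α P' s => ?_⟩, h⟩
  obtain ⟨Q', h1, h2⟩ := hstep P Q hPQ α P' s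
  exact ⟨Q, Q', Relation.ReflTransGen.refl, Or.inl h1, hPQ, h2⟩

theorem BBisim.refl (P : Proc Act) : BBisim P P :=
  bbisim_of_strong (R := fun X Y => X = Y) (fun _ _ h => h.symm)
    (by rintro P _ rfl α P' s; exact ⟨P', s, rfl⟩) rfl

theorem BBisim.symm {P Q : Proc Act} (h : BBisim P Q) : BBisim Q P :=
  isBranchingBisimulation_bbisim.1 _ _ h

theorem WBisim.symm {P Q : Proc Act} (h : WBisim P Q) : WBisim Q P :=
  isWeakBisimulation_wbisim.1 _ _ h

theorem BBisim.silentSteps {P Q P' : Proc Act} (h : BBisim P Q) (hs : SilentSteps P P') :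
    ∃ Q', SilentSteps Q Q' ∧ BBisim P' Q' := by
  induction hs with
  | refl => exact ⟨Q, Relation.ReflTransGen.refl, h⟩
  | tail _ s ih =>
    obtain ⟨Q₁, h1, h2⟩ := ih
    obtain ⟨Q'', Q', h3, h4, -, h6⟩ := isBranchingBisimulation_bbisim.2 _ _ h2 _ _ s
    exact ⟨Q', (h1.trans h3).trans h4.silentSteps, h6⟩

theorem WBisim.silentSteps {P Q P' : Proc Act} (h : WBisim P Q) (hs : SilentSteps P P') :
    ∃ Q', SilentSteps Q Q' ∧ WBisim P' Q' := by
  induction hs with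
  | refl => exact ⟨Q, Relation.ReflTransGen.refl, h⟩
  | tail _ s ih =>
    obtain ⟨Q₁, h1, h2⟩ := ih
    obtain ⟨Q'', Q''', Q', h3, h4, h5, h6⟩ := isWeakBisimulation_wbisim.2 _ _ h2 _ _ s
    exact ⟨Q', ((h1.trans h3).trans h4.silentSteps).trans h5, h6⟩

theorem BBisim.trans {P M Q : Proc Act} (h1 : BBisim P M) (h2 : BBisim M Q) : BBisim P Q := by
  refine ⟨fun X Y => ∃ Z, BBisim X Z ∧ BBisim Z Y, ⟨?_, ?_⟩, M, h1, h2⟩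
  · rintro X Y ⟨Z, a, b⟩
    exact ⟨Z, b.symm, a.symm⟩
  · rintro X Y ⟨Z, a, b⟩ α X' s
    obtain ⟨Z'', Z', c1, c2, c3, c4⟩ := isBranchingBisimulation_bbisim.2 _ _ a _ _ s
    obtain ⟨Y₁, d1, d2⟩ := b.silentSteps c1
    rcases c2 with c2 | ⟨rfl, rfl⟩
    · obtain ⟨Y'', Y', e1, e2, e3, e4⟩ := isBranchingBisimulation_bbisim.2 _ _ d2 _ _ c2
      exact ⟨Y'', Y', d1.trans e1, e2, ⟨Z'', c3, e3⟩, ⟨Z', c4, e4⟩⟩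
    · exact ⟨Y₁, Y₁, d1, Or.inr ⟨rfl, rfl⟩, ⟨Z'', c3, d2⟩, ⟨Z'', c4, d2⟩⟩

theorem WBisim.trans {P M Q : Proc Act} (h1 : WBisim P M) (h2 : WBisim M Q) : WBisim P Q := by
  refine ⟨fun X Y => ∃ Z, WBisim X Z ∧ WBisim Z Y, ⟨?_, ?_⟩, M, h1, h2⟩
  · rintro X Y ⟨Z, a, b⟩
    exact ⟨Z, b.symm, a.symm⟩
  · rintro X Y ⟨Z, a, b⟩ α X' s
    obtain ⟨Z'', Z''', Z', c1, c2, c3, c4⟩ := isWeakBisimulation_wbisim.2 _ _ a _ _ s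
    obtain ⟨Y₁, d1, d2⟩ := b.silentSteps c1
    rcases c2 with c2 | ⟨rfl, rfl⟩
    · obtain ⟨Y'', Y''', Y₂, e1, e2, e3, e4⟩ := isWeakBisimulation_wbisim.2 _ _ d2 _ _ c2
      obtain ⟨Y', f1, f2⟩ := e4.silentSteps c3
      exact ⟨Y'', Y''', Y', d1.trans e1, e2, e3.trans f1, ⟨Z', c4, f2⟩⟩
    · obtain ⟨Y', f1, f2⟩ := d2.silentSteps c3
      exact ⟨Y₁, Y₁, Y', d1, Or.inr ⟨rfl, rfl⟩, f1, ⟨Z', c4, f2⟩⟩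

theorem BBisim.par {P₁ P₂ Q₁ Q₂ : Proc Act} (h1 : BBisim P₁ Q₁) (h2 : BBisim P₂ Q₂) :
    BBisim (Proc.par P₁ P₂) (Proc.par Q₁ Q₂) := by
  refine ⟨fun X Y => ∃ A B C D, X = Proc.par A B ∧ Y = Proc.par C D ∧ BBisim A C ∧ BBisim B D,
    ⟨?_, ?_⟩, P₁, P₂, Q₁, Q₂, rfl, rfl, h1, h2⟩
  · rintro X Y ⟨A, B, C, D, rfl, rfl, a, b⟩
    exact ⟨C, D, A, B, rfl, rfl, a.symm, b.symm⟩
  · rintro X Y ⟨A, B, C, D, rfl, rfl, a, b⟩ α X' s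
    cases s with
    | parL _ s =>
      obtain ⟨C'', C', e1, e2, e3, e4⟩ := isBranchingBisimulation_bbisim.2 _ _ a _ _ s
      exact ⟨_, _, e1.parL D, e2.parL D, ⟨_, _, _, _, rfl, rfl, e3, b⟩,
        ⟨_, _, _, _, rfl, rfl, e4, b⟩⟩
    | parR _ s =>
      obtain ⟨D'', D', e1, e2, e3, e4⟩ := isBranchingBisimulation_bbisim.2 _ _ b _ _ s
      exact ⟨_, _, e1.parR C, e2.parR C, ⟨_, _, _, _, rfl, rfl, a, e3⟩,
        ⟨_, _, _, _, rfl, rfl, a, e4⟩⟩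

theorem WBisim.par {P₁ P₂ Q₁ Q₂ : Proc Act} (h1 : WBisim P₁ Q₁) (h2 : WBisim P₂ Q₂) :
    WBisim (Proc.par P₁ P₂) (Proc.par Q₁ Q₂) := by
  refine ⟨fun X Y => ∃ A B C D, X = Proc.par A B ∧ Y = Proc.par C D ∧ WBisim A C ∧ WBisim B D,
    ⟨?_, ?_⟩, P₁, P₂, Q₁, Q₂, rfl, rfl, h1, h2⟩
  · rintro X Y ⟨A, B, C, D, rfl, rfl, a, b⟩
    exact ⟨C, D, A, B, rfl, rfl, a.symm, b.symm⟩
  · rintro X Y ⟨A, B, C, D, rfl, rfl, a, b⟩ α X' s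
    cases s with
    | parL _ s =>
      obtain ⟨C'', C''', C', e1, e2, e3, e4⟩ := isWeakBisimulation_wbisim.2 _ _ a _ _ s
      exact ⟨_, _, _, e1.parL D, e2.parL D, e3.parL D, ⟨_, _, _, _, rfl, rfl, e4, b⟩⟩
    | parR _ s =>
      obtain ⟨D'', D''', D', e1, e2, e3, e4⟩ := isWeakBisimulation_wbisim.2 _ _ b _ _ s
      exact ⟨_, _, _, e1.parR C, e2.parR C, e3.parR C, ⟨_, _, _, _, rfl, rfl, a, e4⟩⟩

theorem bbisim_par_comm (P Q : Proc Act) : BBisim (Proc.par P Q) (Proc.par Q P) := by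
  refine bbisim_of_strong
    (R := fun X Y => ∃ A B, X = Proc.par A B ∧ Y = Proc.par B A) ?_ ?_ ⟨P, Q, rfl, rfl⟩
  · rintro X Y ⟨A, B, rfl, rfl⟩
    exact ⟨B, A, rfl, rfl⟩
  · rintro X Y ⟨A, B, rfl, rfl⟩ α X' s
    cases s with
    | parL _ s => exact ⟨_, Step.parR _ s, _, _, rfl, rfl⟩
    | parR _ s => exact ⟨_, Step.parL _ s, _, _, rfl, rfl⟩

theorem bbisim_nil_par (P : Proc Act) : BBisim (Proc.par Proc.nil P) P := by
  refine bbisim_of_strong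
    (R := fun X Y => X = Proc.par Proc.nil Y ∨ Y = Proc.par Proc.nil X) ?_ ?_ (Or.inl rfl)
  · rintro X Y (h | h)
    · exact Or.inr h
    · exact Or.inl h
  · rintro X Y (rfl | rfl) α X' s
    · cases s with
      | parL _ s => cases s
      | parR _ s => exact ⟨_, s, Or.inl rfl⟩
    · exact ⟨_, Step.parR _ s, Or.inr rfl⟩

theorem bbisim_par_assoc (P Q S : Proc Act) :
    BBisim (Proc.par (Proc.par P Q) S) (Proc.par P (Proc.par Q S)) := by
  refine bbisim_of_strong
    (R := fun X Y => ∃ A B C,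
      (X = Proc.par (Proc.par A B) C ∧ Y = Proc.par A (Proc.par B C)) ∨
      (Y = Proc.par (Proc.par A B) C ∧ X = Proc.par A (Proc.par B C)))
    ?_ ?_ ⟨P, Q, S, Or.inl ⟨rfl, rfl⟩⟩
  · rintro X Y ⟨A, B, C, h | h⟩
    · exact ⟨A, B, C, Or.inr h⟩
    · exact ⟨A, B, C, Or.inl h⟩
  · rintro X Y ⟨A, B, C, ⟨rfl, rfl⟩ | ⟨rfl, rfl⟩⟩ α X' s
    · cases s with
      | parL _ s =>
        cases s with
        | parL _ s => exact ⟨_, Step.parL _ s, _, _, _, Or.inl ⟨rfl, rfl⟩⟩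
        | parR _ s => exact ⟨_, Step.parR _ (Step.parL _ s), _, _, _, Or.inl ⟨rfl, rfl⟩⟩
      | parR _ s => exact ⟨_, Step.parR _ (Step.parR _ s), _, _, _, Or.inl ⟨rfl, rfl⟩⟩
    · cases s with
      | parL _ s => exact ⟨_, Step.parL _ (Step.parL _ s), _, _, _, Or.inr ⟨rfl, rfl⟩⟩
      | parR _ s =>
        cases s with
        | parL _ s => exact ⟨_, Step.parL _ (Step.parR _ s), _, _, _, Or.inr ⟨rfl, rfl⟩⟩
        | parR _ s => exact ⟨_, Step.parR _ s, _, _, _, Or.inr ⟨rfl, rfl⟩⟩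

theorem Step.eq_par {P Q X : Proc Act} {α : Label Act} (h : Step (Proc.par P Q) α X) :
    (∃ P', Step P α P' ∧ X = Proc.par P' Q) ∨ (∃ Q', Step Q α Q' ∧ X = Proc.par P Q') := by
  cases h with
  | parL _ s => exact Or.inl ⟨_, s, rfl⟩
  | parR _ s => exact Or.inr ⟨_, s, rfl⟩

theorem SilentSteps.eq_par {P Q X : Proc Act} (h : SilentSteps (Proc.par P Q) X) :
    ∃ P' Q', SilentSteps P P' ∧ SilentSteps Q Q' ∧ X = Proc.par P' Q' := by
  induction h with
  | refl => exact ⟨P, Q, Relation.ReflTransGen.refl, Relation.ReflTransGen.refl, rfl⟩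
  | tail _ s ih =>
    obtain ⟨P', Q', h1, h2, rfl⟩ := ih
    rcases s.eq_par with ⟨P'', s', rfl⟩ | ⟨Q'', s', rfl⟩
    · exact ⟨P'', Q', Relation.ReflTransGen.tail h1 s', h2, rfl⟩
    · exact ⟨P', Q'', h1, Relation.ReflTransGen.tail h2 s', rfl⟩

theorem WeakRun.silent {P S : Proc Act} (h : SilentSteps P S) {w : List Act} {P' : Proc Act}
    (hr : WeakRun S w P') : ∃ P'', WeakRun P w P'' := by
  cases w with
  | nil => exact ⟨P, rfl⟩
  | cons a w =>
    obtain ⟨T, ⟨A, B, h1, h2, h3⟩, hr⟩ := hr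
    exact ⟨P', T, ⟨A, B, h.trans h1, h2, h3⟩, hr⟩

theorem WeakRun.exists_par {w : List Act} : ∀ {P Q X : Proc Act}, WeakRun (Proc.par P Q) w X →
    ∃ v v' P' Q', WeakRun P v P' ∧ WeakRun Q v' Q' ∧ w.length = v.length + v'.length := by
  induction w with
  | nil => intro P Q X _; exact ⟨[], [], P, Q, rfl, rfl, rfl⟩
  | cons a w ih =>
    rintro P Q X ⟨T, ⟨A, B, h1, h2, h3⟩, hr⟩
    obtain ⟨P₁, Q₁, p1, q1, rfl⟩ := h1.eq_par
    rcases h2.eq_par with ⟨P₂, s, rfl⟩ | ⟨Q₂, s, rfl⟩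
    · obtain ⟨P₃, Q₃, p3, q3, rfl⟩ := h3.eq_par
      obtain ⟨v, v', P', Q', hv, hv', hl⟩ := ih hr
      obtain ⟨Q'', hq⟩ := WeakRun.silent (q1.trans q3) hv'
      exact ⟨a :: v, v', P', Q'', ⟨P₃, ⟨_, _, p1, s, p3⟩, hv⟩, hq,
        by simp only [List.length_cons]; omega⟩
    · obtain ⟨P₃, Q₃, p3, q3, rfl⟩ := h3.eq_par
      obtain ⟨v, v', P', Q', hv, hv', hl⟩ := ih hr
      obtain ⟨P'', hp⟩ := WeakRun.silent (p1.trans p3) hv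
      exact ⟨v, a :: v', P'', Q', hp, ⟨Q₃, ⟨_, _, q1, s, q3⟩, hv'⟩,
        by simp only [List.length_cons]; omega⟩

theorem WeaklyBounded.par {P Q : Proc Act} (hP : WeaklyBounded P) (hQ : WeaklyBounded Q) :
    WeaklyBounded (Proc.par P Q) := by
  obtain ⟨k, hk⟩ := hP
  obtain ⟨l, hl⟩ := hQ
  refine ⟨k + l, fun w X h => ?_⟩
  obtain ⟨v, v', P', Q', h1, h2, h3⟩ := h.exists_par
  have := hk v P' h1
  have := hl v' Q' h2
  omega

theorem weaklyBounded_nil : WeaklyBounded (Proc.nil : Proc Act) := by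
  refine ⟨0, fun w X h => ?_⟩
  cases w with
  | nil => exact le_rfl
  | cons a w =>
    obtain ⟨T, ⟨A, B, h1, h2, -⟩, -⟩ := h
    have hA : A = Proc.nil := by
      rcases Relation.ReflTransGen.cases_head h1 with h | ⟨C, hc, -⟩
      · exact h.symm
      · cases hc
    subst hA
    cases h2

/-! ### The commutative monoids of processes -/

/-- Branching bisimilarity as an equivalence relation. -/
def bbisimSetoid (Act : Type u) : Setoid (Proc Act) where
  r := BBisim
  iseqv := ⟨BBisim.refl, BBisim.symm, BBisim.trans⟩

/-- Weak bisimilarity as an equivalence relation. -/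
def wbisimSetoid (Act : Type u) : Setoid (Proc Act) where
  r := WBisim
  iseqv := ⟨fun P => (BBisim.refl P).wbisim, WBisim.symm, WBisim.trans⟩

/-- Process expressions modulo branching bisimilarity. -/
def BProc (Act : Type u) : Type u := Quotient (bbisimSetoid Act)

/-- Process expressions modulo weak bisimilarity. -/
def WProc (Act : Type u) : Type u := Quotient (wbisimSetoid Act)

/-- The branching bisimilarity class of a process expression. -/
def BProc.mk (P : Proc Act) : BProc Act := Quotient.mk (bbisimSetoid Act) P

/-- The weak bisimilarity class of a process expression. -/
def WProc.mk (P : Proc Act) : WProc Act := Quotient.mk (wbisimSetoid Act) P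

/-- `[P] ∥ [Q] = [P ∥ Q]`, with identity element `[0]`; the monoid is written multiplicatively. -/
instance (Act : Type u) : CommMonoid (BProc Act) where
  mul := Quotient.map₂ Proc.par (fun _ _ h1 _ _ h2 => BBisim.par h1 h2)
  one := BProc.mk Proc.nil
  mul_assoc := by
    rintro ⟨P⟩ ⟨Q⟩ ⟨S⟩
    exact Quotient.sound (bbisim_par_assoc P Q S)
  mul_comm := by
    rintro ⟨P⟩ ⟨Q⟩
    exact Quotient.sound (bbisim_par_comm P Q)
  one_mul := by
    rintro ⟨P⟩
    exact Quotient.sound (bbisim_nil_par P)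
  mul_one := by
    rintro ⟨P⟩
    exact Quotient.sound ((bbisim_par_comm P Proc.nil).trans (bbisim_nil_par P))

/-- `[P] ∥ [Q] = [P ∥ Q]`, with identity element `[0]`; the monoid is written multiplicatively. -/
instance (Act : Type u) : CommMonoid (WProc Act) where
  mul := Quotient.map₂ Proc.par (fun _ _ h1 _ _ h2 => WBisim.par h1 h2)
  one := WProc.mk Proc.nil
  mul_assoc := by
    rintro ⟨P⟩ ⟨Q⟩ ⟨S⟩
    exact Quotient.sound (bbisim_par_assoc P Q S).wbisim
  mul_comm := by
    rintro ⟨P⟩ ⟨Q⟩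
    exact Quotient.sound (bbisim_par_comm P Q).wbisim
  one_mul := by
    rintro ⟨P⟩
    exact Quotient.sound (bbisim_nil_par P).wbisim
  mul_one := by
    rintro ⟨P⟩
    exact Quotient.sound ((bbisim_par_comm P Proc.nil).trans (bbisim_nil_par P)).wbisim

/-- The submonoid of branching bisimilarity classes of weakly bounded process expressions. -/
def BProcFin (Act : Type u) : Submonoid (BProc Act) where
  carrier := {x | ∃ P : Proc Act, WeaklyBounded P ∧ BProc.mk P = x}
  mul_mem' := by
    rintro _ _ ⟨P, hP, rfl⟩ ⟨Q, hQ, rfl⟩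
    exact ⟨Proc.par P Q, hP.par hQ, rfl⟩
  one_mem' := ⟨Proc.nil, weaklyBounded_nil, rfl⟩

/-- The submonoid of weak bisimilarity classes of weakly bounded process expressions. -/
def WProcFin (Act : Type u) : Submonoid (WProc Act) where
  carrier := {x | ∃ P : Proc Act, WeaklyBounded P ∧ WProc.mk P = x}
  mul_mem' := by
    rintro _ _ ⟨P, hP, rfl⟩ ⟨Q, hQ, rfl⟩
    exact ⟨Proc.par P Q, hP.par hQ, rfl⟩
  one_mem' := ⟨Proc.nil, weaklyBounded_nil, rfl⟩

/-! ### Unique decomposition in commutative monoids -/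

/-- An element different from the identity that is not a product of two non-identity elements. -/
def Indecomposable {M : Type u} [CommMonoid M] (p : M) : Prop :=
  p ≠ 1 ∧ ∀ x y : M, p = x * y → x = 1 ∨ y = 1

/-- `d` is a decomposition of `x`: a finite multiset of indecomposables with composition `x`. -/
def IsDecompositionOf {M : Type u} [CommMonoid M] (d : Multiset M) (x : M) : Prop :=
  (∀ p ∈ d, Indecomposable p) ∧ d.prod = x

/-- Every element has exactly one decomposition. -/
def HasUniqueDecomposition (M : Type u) [CommMonoid M] : Prop :=
  ∀ x : M, ∃! d : Multiset M, IsDecompositionOf d x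

end BCCS

/-! Order the classes by reachability: `x ≤ y` if a representative of `y` has a run to a
representative of `x`. The maximal number of visible actions in a run is additive under parallel
composition and vanishes only at the identity, so decompositions exist. Silent steps may change the
class without lowering this number; hence antisymmetry rests on the stuttering lemma
`bisim_of_silentSteps`, and well-foundedness on the finiteness of the set of derivatives. An element
below a product is a product of elements below the factors.

Uniqueness goes by well-founded induction on the element `x`. Let `p` be maximal among the
indecomposables in two decompositions of `x`, and collect its copies: `x = p ^ k * u = p ^ l * v`
with `l ≤ k`. By maximality `p` lies neither below `u` nor below `v`. If `l < k`, then `p ^ k ≤ p ^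
l * v` contradicts the counting bound `count_le`, unless `p ^ k = x` and `l = k - 1`. What remains
is to cancel the power of `p` in `p ^ k * u = p ^ k * v` or in `p ^ l * p = p ^ l * v`.

This cancellation (`powerCancellation`) uses more than the order. The elements `r` with `p ^ k * r =
p ^ k * x` that equal `p` or are not above `p` are shown to be bisimilar. A step that stays among
them is silent and is matched by idling. Any other step leads strictly below `p ^ k * x`, where
decompositions are unique. It is matched in the context of `k` copies of `p`, and counting these
copies in the result shows that the answer can be given by the last component alone
(`exists_move_of_parPow`). -/

namespace BCCS

universe u

/-! ### Unique decomposition from a weak decomposition order -/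

section Order

variable {M : Type u} [CommMonoid M]

/-- `x` has at most one decomposition. -/
def UniquelyDecomposable (x : M) : Prop :=
  ∀ d e : Multiset M, IsDecompositionOf d x → IsDecompositionOf e x → d = e

theorem IsDecompositionOf.mul {x y : M} {d e : Multiset M} (hd : IsDecompositionOf d x)
    (he : IsDecompositionOf e y) : IsDecompositionOf (d + e) (x * y) := by
  refine ⟨fun p hp => ?_, by rw [Multiset.prod_add, hd.2, he.2]⟩
  rcases Multiset.mem_add.1 hp with h | h
  · exact hd.1 p h
  · exact he.1 p h

theorem Indecomposable.isDecompositionOf_replicate {p : M} (hp : Indecomposable p) (n : ℕ) :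
    IsDecompositionOf (Multiset.replicate n p) (p ^ n) :=
  ⟨fun q hq => by rw [Multiset.eq_of_mem_replicate hq]; exact hp, Multiset.prod_replicate n p⟩

variable [PartialOrder M]

/-- A well-founded partial order with least element `1` that is compatible with multiplication
and precompositional, together with an additive size vanishing only at `1`. -/
structure IsWeakDecompositionOrder (d : M → ℕ) : Prop where
  one_le : ∀ x : M, 1 ≤ x
  mul_le : ∀ {x y : M} (z : M), x ≤ y → x * z ≤ y * z
  le_mul : ∀ {x y z : M}, x ≤ y * z → ∃ y' z', y' ≤ y ∧ z' ≤ z ∧ x = y' * z'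
  wf : WellFounded (fun x y : M => x < y)
  size_mul : ∀ x y, d (x * y) = d x + d y
  size_eq_zero : ∀ x, d x = 0 → x = 1

variable {d : M → ℕ}

namespace IsWeakDecompositionOrder

theorem le_mul_right (h : IsWeakDecompositionOrder d) (x y : M) : x ≤ x * y := by
  have := h.mul_le x (h.one_le y)
  rwa [one_mul, mul_comm] at this

theorem le_mul_left (h : IsWeakDecompositionOrder d) (x y : M) : x ≤ y * x := by
  rw [mul_comm]; exact h.le_mul_right x y

theorem size_pos (h : IsWeakDecompositionOrder d) {p : M} (hp : Indecomposable p) : 0 < d p :=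
  Nat.pos_of_ne_zero fun h0 => hp.1 (h.size_eq_zero p h0)

theorem not_le_one (h : IsWeakDecompositionOrder d) {p : M} (hp : Indecomposable p) : ¬ p ≤ 1 :=
  fun hl => hp.1 (le_antisymm hl (h.one_le p))

theorem exists_decomposition (h : IsWeakDecompositionOrder d) (x : M) :
    ∃ e, IsDecompositionOf e x := by
  induction hn : d x using Nat.strong_induction_on generalizing x with
  | _ n ih =>
    by_cases h1 : x = 1
    · exact ⟨0, by simp, by simp [h1]⟩
    by_cases hx : Indecomposable x
    · exact ⟨{x}, by simpa using hx, by simp⟩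
    simp only [Indecomposable, not_and, not_forall, not_or] at hx
    obtain ⟨y, z, rfl, hy, hz⟩ := hx h1
    have hs := h.size_mul y z
    have hy' : d y ≠ 0 := fun h0 => hy (h.size_eq_zero y h0)
    have hz' : d z ≠ 0 := fun h0 => hz (h.size_eq_zero z h0)
    obtain ⟨e, he⟩ := ih (d y) (by omega) y rfl
    obtain ⟨f, hf⟩ := ih (d z) (by omega) z rfl
    exact ⟨e + f, he.mul hf⟩

theorem le_of_mem (h : IsWeakDecompositionOrder d) {x p : M} {e : Multiset M}
    (he : IsDecompositionOf e x) (hp : p ∈ e) : p ≤ x := by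
  obtain ⟨f, rfl⟩ := Multiset.exists_cons_of_mem hp
  rw [← he.2, Multiset.prod_cons]
  exact h.le_mul_right _ _

theorem uniquelyDecomposable_right (h : IsWeakDecompositionOrder d) {x y : M}
    (hu : UniquelyDecomposable (x * y)) : UniquelyDecomposable y := by
  intro e f he hf
  obtain ⟨g, hg⟩ := h.exists_decomposition x
  exact add_left_cancel (hu _ _ (hg.mul he) (hg.mul hf))

/-- Cancellation is inherited from multisets: a common decomposition of `x` is removed from the
unique decomposition of the product. -/
theorem mul_left_cancel_of_unique (h : IsWeakDecompositionOrder d) {x y z : M}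
    (hu : UniquelyDecomposable (x * y)) (he : x * y = x * z) : y = z := by
  obtain ⟨g, hg⟩ := h.exists_decomposition x
  obtain ⟨e, hy⟩ := h.exists_decomposition y
  obtain ⟨f, hz⟩ := h.exists_decomposition z
  have := add_left_cancel (hu _ _ (hg.mul hy) (he ▸ hg.mul hz))
  rw [← hy.2, ← hz.2, this]

open Classical in
/-- An element below `p ^ n * v`, where `p` is not below `v`, contains `p` at most `n` times. -/
theorem count_le (h : IsWeakDecompositionOrder d) {p v : M} (hp : Indecomposable p)
    (hv : ¬ p ≤ v) (n : ℕ) : ∀ {x : M} {e : Multiset M}, UniquelyDecomposable x →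
      x ≤ p ^ n * v → IsDecompositionOf e x →
      e.count p ≤ n ∧ (e.count p = n → ∃ v', v' ≤ v ∧ x = p ^ n * v') := by
  induction n with
  | zero =>
    intro x e hu hx he
    rw [pow_zero, one_mul] at hx
    have : e.count p = 0 := Multiset.count_eq_zero.2 fun hm => hv ((h.le_of_mem he hm).trans hx)
    exact ⟨this.le, fun _ => ⟨x, hx, by simp⟩⟩
  | succ n ih =>
    intro x e hu hx he
    rw [pow_succ', mul_assoc] at hx
    obtain ⟨q, y, hq, hy, rfl⟩ := h.le_mul hx
    obtain ⟨eq, heq⟩ := h.exists_decomposition q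
    obtain ⟨ey, hey⟩ := h.exists_decomposition y
    obtain rfl := hu _ _ he (heq.mul hey)
    obtain ⟨i1, i2⟩ := ih (h.uniquelyDecomposable_right hu) hy hey
    -- The factor `q ≤ p` contributes one copy of `p` if `q = p`. Otherwise it contributes none,
    -- since a copy would give `p ≤ q ≤ p`.
    rw [Multiset.count_add]
    by_cases hqp : q = p
    · subst hqp
      have hc : eq = {q} :=
        h.uniquelyDecomposable_right (by rwa [mul_comm] at hu) _ _ heq
          ⟨by simpa using hp, by simp⟩
      rw [hc, Multiset.count_singleton_self]
      refine ⟨by omega, fun hn => ?_⟩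
      obtain ⟨v', hv', rfl⟩ := i2 (by omega)
      exact ⟨v', hv', by rw [pow_succ', mul_assoc]⟩
    · have : eq.count p = 0 :=
        Multiset.count_eq_zero.2 fun hm => hqp (le_antisymm hq (h.le_of_mem heq hm))
      exact ⟨by omega, fun hn => by omega⟩

/-- Splitting `p` along the product leaves a single nontrivial piece, because `p` is indecomposable.
-/
theorem exists_le_of_le_prod (h : IsWeakDecompositionOrder d) {p : M} (hp : Indecomposable p)
    (e : Multiset M) : p ≤ e.prod → ∃ q ∈ e, p ≤ q := by
  induction e using Multiset.induction_on with
  | empty => intro hl; exact absurd (by simpa using hl) (h.not_le_one hp)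
  | cons a s ih =>
    intro hl
    rw [Multiset.prod_cons] at hl
    obtain ⟨y, z, hy, hz, rfl⟩ := h.le_mul hl
    rcases hp.2 y z rfl with rfl | rfl
    · rw [one_mul] at ih ⊢
      obtain ⟨q, hq, hq'⟩ := ih hz
      exact ⟨q, Multiset.mem_cons_of_mem hq, hq'⟩
    · exact ⟨a, Multiset.mem_cons_self a s, by rwa [mul_one]⟩

end IsWeakDecompositionOrder

/-- Powers of an indecomposable `p` can be cancelled in front of `p` and of elements not above
`p`, provided that everything below the product is uniquely decomposable. -/
def PowerCancellation (M : Type u) [CommMonoid M] [PartialOrder M] : Prop :=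
  ∀ (p : M) (k : ℕ) (x y : M), Indecomposable p →
    (∀ z, z < p ^ k * x → UniquelyDecomposable z) → p ^ k * x = p ^ k * y →
    (x = p ∨ ¬ p ≤ x) → (y = p ∨ ¬ p ≤ y) → x = y

-- By maximality of `p`, no factor other than `p` itself is above `p`, so the product of the
-- remaining factors is not above `p` either.
open Classical in
theorem IsWeakDecompositionOrder.exists_eq_replicate_add (h : IsWeakDecompositionOrder d)
    {p x : M} {D : Multiset M} (hp : Indecomposable p) (hD : IsDecompositionOf D x)
    (hmax : ∀ q ∈ D, p ≤ q → q = p) :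
    ∃ D' : Multiset M, D = Multiset.replicate (D.count p) p + D' ∧ ¬ p ≤ D'.prod ∧
      IsDecompositionOf D' D'.prod ∧ x = p ^ D.count p * D'.prod := by
  have hs : D = Multiset.replicate (D.count p) p + D.filter (fun q => ¬ q = p) := by
    conv_lhs => rw [← Multiset.filter_add_not (fun q => q = p) D]
    congr 1
    convert Multiset.filter_eq' D p
  refine ⟨D.filter (fun q => ¬ q = p), hs, fun hl => ?_,
    ⟨fun q hq => hD.1 q (Multiset.mem_filter.1 hq).1, rfl⟩, ?_⟩
  · obtain ⟨q, hq, hpq⟩ := h.exists_le_of_le_prod hp _ hl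
    exact (Multiset.mem_filter.1 hq).2 (hmax q (Multiset.mem_filter.1 hq).1 hpq)
  · conv_lhs => rw [← hD.2, hs]
    rw [Multiset.prod_add, Multiset.prod_replicate]

-- The inductive step. Equal multiplicities of `p` reduce to a smaller element by cancellation;
-- unequal ones are contradictory.
open Classical in
theorem IsWeakDecompositionOrder.eq_of_count_le (h : IsWeakDecompositionOrder d)
    (hc : PowerCancellation M) {x p : M} {D E : Multiset M}
    (ih : ∀ z, z < x → UniquelyDecomposable z) (hD : IsDecompositionOf D x)
    (hE : IsDecompositionOf E x) (hp : p ∈ D + E) (hmax : ∀ q ∈ D + E, p ≤ q → q = p)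
    (hle : E.count p ≤ D.count p) : D = E := by
  have hpi : Indecomposable p := by
    rcases Multiset.mem_add.1 hp with h | h
    · exact hD.1 p h
    · exact hE.1 p h
  obtain ⟨D', hD1, hD2, hD3, hD4⟩ := h.exists_eq_replicate_add hpi hD
    fun q hq => hmax q (Multiset.mem_add.2 (Or.inl hq))
  obtain ⟨E', hE1, hE2, hE3, hE4⟩ := h.exists_eq_replicate_add hpi hE
    fun q hq => hmax q (Multiset.mem_add.2 (Or.inr hq))
  have hcnt : 0 < D.count p := by
    have := Multiset.count_pos.2 hp
    rw [Multiset.count_add] at this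
    omega
  have hpos := h.size_pos hpi
  generalize D.count p = k at *
  generalize E.count p = l at *
  rcases hle.eq_or_lt with rfl | hlt
  · have hxy : D'.prod = E'.prod :=
      hc p l _ _ hpi (hD4 ▸ ih) (hD4.symm.trans hE4) (Or.inr hD2) (Or.inr hE2)
    have hlt : D'.prod < x := by
      -- Equality is excluded by size: `p` occurs at least once and has positive size.
      refine lt_of_le_of_ne (hD4 ▸ h.le_mul_left _ _) fun heq => ?_
      obtain ⟨m, rfl⟩ := Nat.exists_eq_succ_of_ne_zero hcnt.ne'
      have h1 := congrArg d (hD4.symm.trans heq.symm)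
      rw [h.size_mul, pow_succ, h.size_mul] at h1
      omega
    rw [hD1, hE1, ih _ hlt D' E' hD3 (hxy ▸ hE3)]
  · exfalso
    -- Powers of `p` strictly below `x` are uniquely decomposable, so the counting bound for `p ^ l
    -- * E'.prod` applies to them.
    have key : ∀ m, p ^ m ≠ x → p ^ m ≤ x → m ≤ l := by
      intro m hne hl
      have := (h.count_le hpi hE2 l (ih _ (lt_of_le_of_ne hl hne)) (hE4 ▸ hl)
        (hpi.isDecompositionOf_replicate m)).1
      rwa [Multiset.count_replicate_self] at this
    obtain ⟨m, rfl⟩ := Nat.exists_eq_succ_of_ne_zero hcnt.ne'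
    by_cases h1 : p ^ (m + 1) = x
    · have hm : m ≤ l := by
        refine key m (fun heq => ?_) ?_
        · have := congrArg d (h1.trans heq.symm)
          rw [pow_succ, h.size_mul] at this
          omega
        · rw [← h1, pow_succ]
          exact h.le_mul_right _ _
      obtain rfl : m = l := by omega
      rw [pow_succ] at h1
      have := hc p m p E'.prod hpi (h1 ▸ ih) (h1.trans hE4) (Or.inl rfl) (Or.inr hE2)
      exact hE2 this.le
    · have := key (m + 1) h1 (hD4 ▸ h.le_mul_right _ _)
      omega

theorem IsWeakDecompositionOrder.hasUniqueDecomposition (h : IsWeakDecompositionOrder d)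
    (hc : PowerCancellation M) : HasUniqueDecomposition M := by
  classical
  have main : ∀ x : M, UniquelyDecomposable x := by
    intro x
    induction x using h.wf.induction with
    | _ x ih =>
      intro D E hD hE
      by_cases hne : D + E = 0
      · simp only [add_eq_zero] at hne
        rw [hne.1, hne.2]
      obtain ⟨q, hq⟩ := Multiset.exists_mem_of_ne_zero hne
      obtain ⟨p, hp⟩ := (D + E).toFinset.exists_maximal ⟨q, Multiset.mem_toFinset.2 hq⟩
      have hmem := Multiset.mem_toFinset.1 hp.1
      have hmax : ∀ q ∈ D + E, p ≤ q → q = p := fun q hq hpq =>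
        le_antisymm (hp.2 (Multiset.mem_toFinset.2 hq) hpq) hpq
      rcases le_total (E.count p) (D.count p) with hle | hle
      · exact h.eq_of_count_le hc ih hD hE hmem hmax hle
      · rw [add_comm] at hmem hmax
        exact (h.eq_of_count_le hc ih hE hD hmem hmax hle).symm
  intro x
  obtain ⟨e, he⟩ := h.exists_decomposition x
  exact ⟨e, he, fun f hf => main x f e hf he⟩

end Order

variable {Act : Type u}

/-! ### Runs counted by their visible actions -/

/-- `P` evolves into the second process expression by transitions of which exactly `n` are
visible. -/
inductive VisRun : Proc Act → ℕ → Proc Act → Prop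
  | refl (P : Proc Act) : VisRun P 0 P
  | tau {P Q S : Proc Act} {n : ℕ} : Step P Label.tau Q → VisRun Q n S → VisRun P n S
  | act {P Q S : Proc Act} {n : ℕ} (a : Act) :
      Step P (Label.act a) Q → VisRun Q n S → VisRun P (n + 1) S

theorem VisRun.trans {P Q S : Proc Act} {n m : ℕ} (h : VisRun P n Q) (h' : VisRun Q m S) :
    VisRun P (n + m) S := by
  induction h with
  | refl => rwa [Nat.zero_add]
  | tau s _ ih => exact .tau s (ih h')
  | act a s _ ih => rw [Nat.add_right_comm]; exact .act a s (ih h')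

theorem SilentSteps.visRun {P Q : Proc Act} (h : SilentSteps P Q) : VisRun P 0 Q := by
  induction h using Relation.ReflTransGen.head_induction_on with
  | refl => exact .refl _
  | head s _ ih => exact .tau s ih

theorem VisRun.silentSteps {P Q : Proc Act} {n : ℕ} (h : VisRun P n Q) (hn : n = 0) :
    SilentSteps P Q := by
  induction h with
  | refl => exact Relation.ReflTransGen.refl
  | tau s _ ih => exact Relation.ReflTransGen.head s (ih hn)
  | act => omega

theorem Step.exists_visRun {P Q : Proc Act} {α : Label Act} (h : Step P α Q) :
    ∃ n, VisRun P n Q ∧ (n = 0 → α = Label.tau) := by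
  cases α with
  | tau => exact ⟨0, .tau h (.refl _), fun _ => rfl⟩
  | act a => exact ⟨1, .act a h (.refl _), fun h => absurd h one_ne_zero⟩

theorem OptStep.exists_visRun {P Q : Proc Act} {α : Label Act} (h : OptStep P α Q) :
    ∃ n, VisRun P n Q ∧ (n = 0 → α = Label.tau) := by
  rcases h with h | ⟨h, rfl⟩
  · exact h.exists_visRun
  · exact ⟨0, .refl _, fun _ => h⟩

theorem VisRun.parL {P P' : Proc Act} {n : ℕ} (Q : Proc Act) (h : VisRun P n P') :
    VisRun (Proc.par P Q) n (Proc.par P' Q) := by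
  induction h with
  | refl => exact .refl _
  | tau s _ ih => exact .tau (.parL Q s) ih
  | act a s _ ih => exact .act a (.parL Q s) ih

theorem VisRun.parR {Q Q' : Proc Act} {n : ℕ} (P : Proc Act) (h : VisRun Q n Q') :
    VisRun (Proc.par P Q) n (Proc.par P Q') := by
  induction h with
  | refl => exact .refl _
  | tau s _ ih => exact .tau (.parR P s) ih
  | act a s _ ih => exact .act a (.parR P s) ih

theorem VisRun.eq_par {T X : Proc Act} {n : ℕ} (h : VisRun T n X) :
    ∀ {P Q : Proc Act}, T = Proc.par P Q → ∃ i j P' Q', VisRun P i P' ∧ VisRun Q j Q' ∧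
      n = i + j ∧ X = Proc.par P' Q' := by
  induction h with
  | refl => rintro P Q rfl; exact ⟨0, 0, P, Q, .refl _, .refl _, rfl, rfl⟩
  | tau s _ ih =>
    rintro P Q rfl
    rcases s.eq_par with ⟨P₁, s', rfl⟩ | ⟨Q₁, s', rfl⟩
    · obtain ⟨i, j, P', Q', h1, h2, h3, h4⟩ := ih rfl
      exact ⟨i, j, P', Q', .tau s' h1, h2, h3, h4⟩
    · obtain ⟨i, j, P', Q', h1, h2, h3, h4⟩ := ih rfl
      exact ⟨i, j, P', Q', h1, .tau s' h2, h3, h4⟩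
  | act a s _ ih =>
    rintro P Q rfl
    rcases s.eq_par with ⟨P₁, s', rfl⟩ | ⟨Q₁, s', rfl⟩
    · obtain ⟨i, j, P', Q', h1, h2, h3, h4⟩ := ih rfl
      exact ⟨i + 1, j, P', Q', .act a s' h1, h2, by omega, h4⟩
    · obtain ⟨i, j, P', Q', h1, h2, h3, h4⟩ := ih rfl
      exact ⟨i, j + 1, P', Q', h1, .act a s' h2, by omega, h4⟩

theorem WeakRun.visRun {w : List Act} : ∀ {P Q : Proc Act}, WeakRun P w Q →
    VisRun P w.length Q := by
  induction w with
  | nil => rintro P _ rfl; exact .refl _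
  | cons a w ih =>
    rintro P Q ⟨S, ⟨A, B, h1, h2, h3⟩, h4⟩
    have := (h1.visRun.trans (.act a h2 h3.visRun)).trans (ih h4)
    convert this using 1
    simp only [List.length_cons]
    omega

/-- Only the length survives: an empty weak run cannot absorb silent steps, so the end point may
change. -/
theorem VisRun.exists_weakRun {P Q : Proc Act} {n : ℕ} (h : VisRun P n Q) :
    ∃ w Q', WeakRun P w Q' ∧ w.length = n := by
  induction h with
  | refl P => exact ⟨[], P, rfl, rfl⟩
  | tau s _ ih =>
    obtain ⟨w, Q', h1, h2⟩ := ih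
    obtain ⟨Q'', h3⟩ := h1.silent (Relation.ReflTransGen.single s)
    exact ⟨w, Q'', h3, h2⟩
  | act a s _ ih =>
    obtain ⟨w, Q', h1, h2⟩ := ih
    exact ⟨a :: w, Q', ⟨_, ⟨_, _, Relation.ReflTransGen.refl, s, Relation.ReflTransGen.refl⟩, h1⟩,
      by simp [h2]⟩

theorem weaklyBounded_iff {P : Proc Act} :
    WeaklyBounded P ↔ ∃ k, ∀ n Q, VisRun P n Q → n ≤ k := by
  constructor
  · rintro ⟨k, hk⟩
    refine ⟨k, fun n Q h => ?_⟩
    obtain ⟨w, Q', h1, rfl⟩ := h.exists_weakRun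
    exact hk w Q' h1
  · rintro ⟨k, hk⟩
    exact ⟨k, fun w Q h => hk _ _ h.visRun⟩

theorem WeaklyBounded.of_visRun {P Q : Proc Act} {n : ℕ} (hP : WeaklyBounded P)
    (h : VisRun P n Q) : WeaklyBounded Q := by
  obtain ⟨k, hk⟩ := weaklyBounded_iff.1 hP
  refine weaklyBounded_iff.2 ⟨k, fun m S hS => ?_⟩
  have := hk _ _ (h.trans hS)
  omega

/-- The maximal number of visible transitions in a run. -/
noncomputable def depth (P : Proc Act) : ℕ := sSup {n | ∃ Q, VisRun P n Q}

theorem WeaklyBounded.bddAbove {P : Proc Act} (hP : WeaklyBounded P) :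
    BddAbove {n | ∃ Q, VisRun P n Q} := by
  obtain ⟨k, hk⟩ := weaklyBounded_iff.1 hP
  exact ⟨k, fun n ⟨Q, h⟩ => hk n Q h⟩

theorem WeaklyBounded.le_depth {P Q : Proc Act} {n : ℕ} (hP : WeaklyBounded P)
    (h : VisRun P n Q) : n ≤ depth P :=
  le_csSup hP.bddAbove ⟨Q, h⟩

theorem WeaklyBounded.exists_visRun_depth {P : Proc Act} (hP : WeaklyBounded P) :
    ∃ Q, VisRun P (depth P) Q :=
  Nat.sSup_mem (s := {n | ∃ Q, VisRun P n Q}) ⟨0, P, .refl P⟩ hP.bddAbove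

theorem WeaklyBounded.add_depth_le {P Q : Proc Act} {n : ℕ} (hP : WeaklyBounded P)
    (h : VisRun P n Q) : n + depth Q ≤ depth P := by
  obtain ⟨S, hS⟩ := (hP.of_visRun h).exists_visRun_depth
  exact hP.le_depth (h.trans hS)

theorem depth_par {P Q : Proc Act} (hP : WeaklyBounded P) (hQ : WeaklyBounded Q) :
    depth (Proc.par P Q) = depth P + depth Q := by
  apply le_antisymm
  · obtain ⟨X, hX⟩ := (hP.par hQ).exists_visRun_depth
    obtain ⟨i, j, P', Q', h1, h2, h3, -⟩ := hX.eq_par rfl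
    have := hP.le_depth h1
    have := hQ.le_depth h2
    omega
  · obtain ⟨P', h1⟩ := hP.exists_visRun_depth
    obtain ⟨Q', h2⟩ := hQ.exists_visRun_depth
    exact (hP.par hQ).le_depth ((h1.parL Q).trans (h2.parR P'))

/-- Every process expression has finitely many derivatives. -/
theorem exists_finite_closed (P : Proc Act) : ∃ S : Set (Proc Act), S.Finite ∧ P ∈ S ∧
    ∀ X ∈ S, ∀ (α : Label Act) (X' : Proc Act), Step X α X' → X' ∈ S := by
  induction P with
  | nil =>
    refine ⟨{Proc.nil}, Set.finite_singleton _, rfl, ?_⟩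
    rintro X rfl α X' s
    cases s
  | pref β P ih =>
    obtain ⟨S, h1, h2, h3⟩ := ih
    refine ⟨insert (Proc.pref β P) S, h1.insert _, Set.mem_insert _ _, ?_⟩
    rintro X (rfl | hX) α X' s
    · cases s
      exact Or.inr h2
    · exact Or.inr (h3 X hX α X' s)
  | alt P Q ihP ihQ =>
    obtain ⟨S, h1, h2, h3⟩ := ihP
    obtain ⟨T, k1, k2, k3⟩ := ihQ
    refine ⟨insert (Proc.alt P Q) (S ∪ T), (h1.union k1).insert _, Set.mem_insert _ _, ?_⟩
    rintro X (rfl | hX | hX) α X' s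
    · cases s with
      | altL _ s => exact Or.inr (Or.inl (h3 _ h2 _ _ s))
      | altR _ s => exact Or.inr (Or.inr (k3 _ k2 _ _ s))
    · exact Or.inr (Or.inl (h3 X hX α X' s))
    · exact Or.inr (Or.inr (k3 X hX α X' s))
  | par P Q ihP ihQ =>
    obtain ⟨S, h1, h2, h3⟩ := ihP
    obtain ⟨T, k1, k2, k3⟩ := ihQ
    -- A derivative of a parallel composition is a pair of derivatives of the components.
    refine ⟨Set.image2 Proc.par S T, h1.image2 _ k1, Set.mem_image2_of_mem h2 k2, ?_⟩
    rintro _ ⟨A, hA, B, hB, rfl⟩ α X' s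
    rcases s.eq_par with ⟨A', s', rfl⟩ | ⟨B', s', rfl⟩
    · exact Set.mem_image2_of_mem (h3 _ hA _ _ s') hB
    · exact Set.mem_image2_of_mem hA (k3 _ hB _ _ s')
  | star β P ih =>
    obtain ⟨S, h1, h2, h3⟩ := ih
    refine ⟨insert (Proc.star β P) S, h1.insert _, Set.mem_insert _ _, ?_⟩
    rintro X (rfl | hX) α X' s
    · cases s with
      | starLoop => exact Set.mem_insert _ _
      | starExit _ s => exact Or.inr (h3 _ h2 _ _ s)
    · exact Or.inr (h3 X hX α X' s)

theorem finite_setOf_visRun (P : Proc Act) : {Q | ∃ n, VisRun P n Q}.Finite := by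
  obtain ⟨S, h1, h2, h3⟩ := exists_finite_closed P
  refine h1.subset ?_
  rintro Q ⟨n, h⟩
  induction h with
  | refl => exact h2
  | tau s _ ih => exact ih (h3 _ h2 _ _ s)
  | act a s _ ih => exact ih (h3 _ h2 _ _ s)

/-! ### A common form of branching and weak bisimilarity -/

/-- `P ⇒ P₁ —(α)→ P₂ ⇒ P₃`. -/
structure Move (α : Label Act) (P P₁ P₂ P₃ : Proc Act) : Prop where
  before : SilentSteps P P₁
  step : OptStep P₁ α P₂
  after : SilentSteps P₂ P₃

/-- `R` is a weak bisimulation, and a branching one if `b` holds. -/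
def IsBisim (b : Prop) (R : Proc Act → Proc Act → Prop) : Prop :=
  (∀ P Q, R P Q → R Q P) ∧
  ∀ P Q, R P Q → ∀ (α : Label Act) (P' : Proc Act), Step P α P' →
    ∃ Q₁ Q₂ Q₃, Move α Q Q₁ Q₂ Q₃ ∧ R P' Q₃ ∧ (b → R P Q₁ ∧ R P' Q₂)

/-- Weak bisimilarity, or branching bisimilarity if `b` holds. -/
def Bisim (b : Prop) (P Q : Proc Act) : Prop :=
  ∃ R : Proc Act → Proc Act → Prop, IsBisim b R ∧ R P Q

theorem bisim_true_iff {P Q : Proc Act} : Bisim True P Q ↔ BBisim P Q := by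
  constructor
  · rintro ⟨R, ⟨hs, hR⟩, h⟩
    refine ⟨R, ⟨hs, fun P Q hPQ α P' s => ?_⟩, h⟩
    obtain ⟨Q₁, Q₂, Q₃, hm, -, h3⟩ := hR P Q hPQ α P' s
    exact ⟨Q₁, Q₂, hm.before, hm.step, (h3 trivial).1, (h3 trivial).2⟩
  · rintro ⟨R, ⟨hs, hR⟩, h⟩
    refine ⟨R, ⟨hs, fun P Q hPQ α P' s => ?_⟩, h⟩
    obtain ⟨Q₁, Q₂, h1, h2, h3, h4⟩ := hR P Q hPQ α P' s
    exact ⟨Q₁, Q₂, Q₂, ⟨h1, h2, Relation.ReflTransGen.refl⟩, h4, fun _ => ⟨h3, h4⟩⟩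

theorem bisim_false_iff {P Q : Proc Act} : Bisim False P Q ↔ WBisim P Q := by
  constructor
  · rintro ⟨R, ⟨hs, hR⟩, h⟩
    refine ⟨R, ⟨hs, fun P Q hPQ α P' s => ?_⟩, h⟩
    obtain ⟨Q₁, Q₂, Q₃, hm, h2, -⟩ := hR P Q hPQ α P' s
    exact ⟨Q₁, Q₂, Q₃, hm.before, hm.step, hm.after, h2⟩
  · rintro ⟨R, ⟨hs, hR⟩, h⟩
    refine ⟨R, ⟨hs, fun P Q hPQ α P' s => ?_⟩, h⟩
    obtain ⟨Q₁, Q₂, Q₃, h1, h2, h3, h4⟩ := hR P Q hPQ α P' s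
    exact ⟨Q₁, Q₂, Q₃, ⟨h1, h2, h3⟩, h4, False.elim⟩

variable {b : Prop}

theorem isBisim_bisim : IsBisim b (Bisim b : Proc Act → Proc Act → Prop) := by
  refine ⟨?_, ?_⟩
  · rintro P Q ⟨R, hR, h⟩
    exact ⟨R, hR, hR.1 _ _ h⟩
  · rintro P Q ⟨R, hR, h⟩ α P' s
    obtain ⟨Q₁, Q₂, Q₃, h1, h2, h3⟩ := hR.2 P Q h α P' s
    exact ⟨Q₁, Q₂, Q₃, h1, ⟨R, hR, h2⟩, fun hb => ⟨⟨R, hR, (h3 hb).1⟩, ⟨R, hR, (h3 hb).2⟩⟩⟩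

theorem Bisim.symm {P Q : Proc Act} (h : Bisim b P Q) : Bisim b Q P :=
  isBisim_bisim.1 _ _ h

theorem Bisim.refl (P : Proc Act) : Bisim b P P := by
  refine ⟨Eq, ⟨fun _ _ h => h.symm, ?_⟩, rfl⟩
  rintro P _ rfl α P' s
  exact ⟨P, P', P', ⟨Relation.ReflTransGen.refl, Or.inl s, Relation.ReflTransGen.refl⟩, rfl,
    fun _ => ⟨rfl, rfl⟩⟩

theorem Bisim.visRun {P P' : Proc Act} {n : ℕ} (h : VisRun P n P') :
    ∀ {Q : Proc Act}, Bisim b P Q → ∃ Q', VisRun Q n Q' ∧ Bisim b P' Q' := by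
  induction h with
  | refl => exact fun {Q} hb => ⟨Q, .refl _, hb⟩
  | tau s _ ih =>
    intro Q hb
    obtain ⟨Q₁, Q₂, Q₃, hm, h1, -⟩ := isBisim_bisim.2 _ _ hb _ _ s
    obtain ⟨Q', h2, h3⟩ := ih h1
    refine ⟨Q', ?_, h3⟩
    have := (hm.before.visRun.trans
      (hm.step.silentSteps.visRun.trans hm.after.visRun)).trans h2
    rwa [Nat.zero_add] at this
  | act a s _ ih =>
    intro Q hb
    obtain ⟨Q₁, Q₂, Q₃, hm, h1, -⟩ := isBisim_bisim.2 _ _ hb _ _ s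
    obtain ⟨Q', h2, h3⟩ := ih h1
    rcases hm.step with hs | ⟨h0, -⟩
    · have := hm.before.visRun.trans (.act a hs (hm.after.visRun.trans h2))
      rw [Nat.zero_add, Nat.zero_add] at this
      exact ⟨Q', this, h3⟩
    · cases h0

theorem Bisim.depth_eq {P Q : Proc Act} (h : Bisim b P Q) : depth P = depth Q := by
  have : {n | ∃ P', VisRun P n P'} = {n | ∃ Q', VisRun Q n Q'} := by
    ext n
    constructor
    · rintro ⟨P', hP⟩
      obtain ⟨Q', hQ, -⟩ := Bisim.visRun hP h
      exact ⟨Q', hQ⟩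
    · rintro ⟨Q', hQ⟩
      obtain ⟨P', hP, -⟩ := Bisim.visRun hQ h.symm
      exact ⟨P', hP⟩
  rw [depth, depth, this]

/-- A process expression on a silent path between two bisimilar ones is bisimilar to them. -/
theorem bisim_of_silentSteps {P Q P' : Proc Act} (h1 : SilentSteps P Q) (h2 : SilentSteps Q P')
    (h3 : Bisim b P P') : Bisim b P Q := by
  -- If `X ⇒ Y ⇒ X'` with `X` bisimilar to `X'`, then `Y` answers steps of `X` by first moving to
  -- `X'`, and `X` answers steps of `Y` by first moving to `Y`.
  let S : Proc Act → Proc Act → Prop := fun X Y =>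
    SilentSteps X Y ∧ ∃ X', SilentSteps Y X' ∧ Bisim b X X'
  refine ⟨fun X Y => Bisim b X Y ∨ S X Y ∨ S Y X, ⟨?_, ?_⟩, Or.inr (Or.inl ⟨h1, P', h2, h3⟩)⟩
  · rintro X Y (h | h | h)
    · exact Or.inl h.symm
    · exact Or.inr (Or.inr h)
    · exact Or.inr (Or.inl h)
  · rintro X Y (h | ⟨h1, X', h2, h3⟩ | ⟨h1, -⟩) α Z s
    · obtain ⟨Q₁, Q₂, Q₃, hm, k1, k2⟩ := isBisim_bisim.2 _ _ h _ _ s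
      exact ⟨Q₁, Q₂, Q₃, hm, Or.inl k1, fun hb => ⟨Or.inl (k2 hb).1, Or.inl (k2 hb).2⟩⟩
    · obtain ⟨Q₁, Q₂, Q₃, hm, k1, k2⟩ := isBisim_bisim.2 _ _ h3 _ _ s
      exact ⟨Q₁, Q₂, Q₃, ⟨h2.trans hm.before, hm.step, hm.after⟩, Or.inl k1,
        fun hb => ⟨Or.inl (k2 hb).1, Or.inl (k2 hb).2⟩⟩
    · exact ⟨X, Z, Z, ⟨h1, Or.inl s, Relation.ReflTransGen.refl⟩, Or.inl (Bisim.refl Z),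
        fun _ => ⟨Or.inl (Bisim.refl X), Or.inl (Bisim.refl Z)⟩⟩

/-- Without visible actions every step is silent and leads to a process of the same kind, so `0`
answers by idling. -/
theorem bisim_nil_of_depth_eq_zero {P : Proc Act} (hP : WeaklyBounded P) (h : depth P = 0) :
    Bisim b P Proc.nil := by
  let S : Proc Act → Proc Act → Prop := fun X Y => (∀ n Z, VisRun X n Z → n = 0) ∧ Y = Proc.nil
  have hS : S P Proc.nil := ⟨fun n Z hZ => by have := hP.le_depth hZ; omega, rfl⟩
  refine ⟨fun X Y => S X Y ∨ S Y X, ⟨fun X Y h => h.symm, ?_⟩, Or.inl hS⟩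
  rintro X Y (⟨hX, rfl⟩ | ⟨-, rfl⟩) α Z s
  · obtain ⟨n, hn, hα⟩ := s.exists_visRun
    have h0 := hX n Z hn
    have hZ : S Z Proc.nil := ⟨fun m W hW => by have := hX _ _ (hn.trans hW); omega, rfl⟩
    exact ⟨Proc.nil, Proc.nil, Proc.nil, ⟨Relation.ReflTransGen.refl, Or.inr ⟨hα h0, rfl⟩,
      Relation.ReflTransGen.refl⟩, Or.inl hZ, fun _ => ⟨Or.inl ⟨hX, rfl⟩, Or.inl hZ⟩⟩
  · cases s

/-- The component that does not perform `α` idles at that moment, so its share is a move labelled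
`τ` with the same three stages. -/
theorem Move.eq_par {α : Label Act} {P Q T₁ T₂ T₃ : Proc Act}
    (h : Move α (Proc.par P Q) T₁ T₂ T₃) :
    ∃ P₁ P₂ P₃ Q₁ Q₂ Q₃, T₁ = Proc.par P₁ Q₁ ∧ T₂ = Proc.par P₂ Q₂ ∧ T₃ = Proc.par P₃ Q₃ ∧
      ((Move α P P₁ P₂ P₃ ∧ Move Label.tau Q Q₁ Q₂ Q₃) ∨
        (Move Label.tau P P₁ P₂ P₃ ∧ Move α Q Q₁ Q₂ Q₃)) := by
  obtain ⟨h1, h2, h3⟩ := h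
  obtain ⟨P₁, Q₁, p1, q1, rfl⟩ := h1.eq_par
  rcases h2 with s | ⟨rfl, rfl⟩
  · rcases s.eq_par with ⟨P₂, s', rfl⟩ | ⟨Q₂, s', rfl⟩
    · obtain ⟨P₃, Q₃, p3, q3, rfl⟩ := h3.eq_par
      exact ⟨P₁, P₂, P₃, Q₁, Q₁, Q₃, rfl, rfl, rfl,
        Or.inl ⟨⟨p1, Or.inl s', p3⟩, ⟨q1, Or.inr ⟨rfl, rfl⟩, q3⟩⟩⟩
    · obtain ⟨P₃, Q₃, p3, q3, rfl⟩ := h3.eq_par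
      exact ⟨P₁, P₁, P₃, Q₁, Q₂, Q₃, rfl, rfl, rfl,
        Or.inr ⟨⟨p1, Or.inr ⟨rfl, rfl⟩, p3⟩, ⟨q1, Or.inl s', q3⟩⟩⟩
  · obtain ⟨P₃, Q₃, p3, q3, rfl⟩ := h3.eq_par
    exact ⟨P₁, P₁, P₃, Q₁, Q₁, Q₃, rfl, rfl, rfl,
      Or.inl ⟨⟨p1, Or.inr ⟨rfl, rfl⟩, p3⟩, ⟨q1, Or.inr ⟨rfl, rfl⟩, q3⟩⟩⟩


/-! ### The decomposition order on bisimilarity classes -/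

/-- `M` is the commutative monoid of the bisimilarity classes of the weakly bounded process
expressions, and `Rep P x` means that `x` is the class of `P`. -/
structure IsClassMonoid {M : Type u} [CommMonoid M] (b : Prop) (Rep : Proc Act → M → Prop) :
    Prop where
  exists_rep : ∀ x, ∃ P, Rep P x
  weaklyBounded : ∀ {P x}, Rep P x → WeaklyBounded P
  exists_class : ∀ {P}, WeaklyBounded P → ∃ x, Rep P x
  eq_iff : ∀ {P Q x y}, Rep P x → Rep Q y → (x = y ↔ Bisim b P Q)
  par : ∀ {P Q x y}, Rep P x → Rep Q y → Rep (Proc.par P Q) (x * y)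
  nil : Rep Proc.nil 1

namespace IsClassMonoid

variable {M : Type u} [CommMonoid M] {Rep : Proc Act → M → Prop}

theorem unique (h : IsClassMonoid b Rep) {P : Proc Act} {x y : M} (hx : Rep P x) (hy : Rep P y) :
    x = y :=
  (h.eq_iff hx hy).2 (Bisim.refl P)

theorem exists_class_of_visRun (h : IsClassMonoid b Rep) {P Q : Proc Act} {x : M} {n : ℕ}
    (hx : Rep P x) (hr : VisRun P n Q) : ∃ y, Rep Q y :=
  h.exists_class ((h.weaklyBounded hx).of_visRun hr)

/-- The maximal number of visible transitions in a run from a representative. -/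
noncomputable def size (h : IsClassMonoid b Rep) (x : M) : ℕ := depth (h.exists_rep x).choose

theorem size_eq (h : IsClassMonoid b Rep) {P : Proc Act} {x : M} (hx : Rep P x) :
    h.size x = depth P :=
  ((h.eq_iff (h.exists_rep x).choose_spec hx).1 rfl).depth_eq

/-- `x` is reachable from `y`. -/
def Below (Rep : Proc Act → M → Prop) (x y : M) : Prop :=
  ∃ P Q n, Rep P x ∧ Rep Q y ∧ VisRun Q n P

theorem exists_visRun (h : IsClassMonoid b Rep) {x y : M} (hxy : Below Rep x y) {Q : Proc Act}
    (hQ : Rep Q y) : ∃ P n, Rep P x ∧ VisRun Q n P := by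
  obtain ⟨P₀, Q₀, n, h1, h2, h3⟩ := hxy
  obtain ⟨P, h4, h5⟩ := Bisim.visRun h3 ((h.eq_iff h2 hQ).1 rfl)
  obtain ⟨x', hx'⟩ := h.exists_class_of_visRun hQ h4
  obtain rfl := (h.eq_iff h1 hx').2 h5
  exact ⟨P, n, hx', h4⟩

/-- A cycle of runs through bisimilar ends cannot lose depth, so both runs are silent and the
stuttering lemma applies. -/
theorem below_antisymm (h : IsClassMonoid b Rep) {x y : M} (hxy : Below Rep x y)
    (hyx : Below Rep y x) : x = y := by
  obtain ⟨P, hP⟩ := h.exists_rep x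
  obtain ⟨Q, n, hQ, r1⟩ := h.exists_visRun hyx hP
  obtain ⟨P', m, hP', r2⟩ := h.exists_visRun hxy hQ
  have h1 := (h.weaklyBounded hP).add_depth_le r1
  have h2 := (h.weaklyBounded hQ).add_depth_le r2
  have hb := (h.eq_iff hP hP').1 rfl
  have h3 := hb.depth_eq
  exact (h.eq_iff hP hQ).2
    (bisim_of_silentSteps (r1.silentSteps (by omega)) (r2.silentSteps (by omega)) hb)

/-- Reachability as a partial order on classes. -/
abbrev order (h : IsClassMonoid b Rep) : PartialOrder M where
  le := Below Rep
  le_refl x := by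
    obtain ⟨P, hP⟩ := h.exists_rep x
    exact ⟨P, P, 0, hP, hP, .refl P⟩
  le_trans x y z hxy hyz := by
    obtain ⟨S, hS⟩ := h.exists_rep z
    obtain ⟨Q, n, hQ, r1⟩ := h.exists_visRun hyz hS
    obtain ⟨P, m, hP, r2⟩ := h.exists_visRun hxy hQ
    exact ⟨P, S, _, hP, hS, r1.trans r2⟩
  le_antisymm _ _ := h.below_antisymm

theorem finite_below (h : IsClassMonoid b Rep) (y : M) : {x | Below Rep x y}.Finite := by
  obtain ⟨Q, hQ⟩ := h.exists_rep y
  have hf : (⋃ P ∈ {P | ∃ n, VisRun Q n P}, {x | Rep P x}).Finite :=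
    (finite_setOf_visRun Q).biUnion fun P _ =>
      Set.Subsingleton.finite fun _ hx _ hy => h.unique hx hy
  refine hf.subset fun x hx => ?_
  obtain ⟨P, n, hP, r⟩ := h.exists_visRun hx hQ
  exact Set.mem_biUnion (show P ∈ {P | ∃ n, VisRun Q n P} from ⟨n, r⟩) hP

theorem isWeakDecompositionOrder (h : IsClassMonoid b Rep) :
    letI := h.order
    IsWeakDecompositionOrder h.size := by
  let := h.order
  refine ⟨fun x => ?_, fun {x y} z hxy => ?_, fun {x y z} hx => ?_, ?_, fun x y => ?_,
    fun x hx => ?_⟩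
  · obtain ⟨P, hP⟩ := h.exists_rep x
    obtain ⟨Q, r⟩ := (h.weaklyBounded hP).exists_visRun_depth
    -- The end of a longest run has depth zero, hence represents the identity.
    have hd := (h.weaklyBounded hP).add_depth_le r
    obtain ⟨y, hy⟩ := h.exists_class_of_visRun hP r
    have := (h.eq_iff hy h.nil).2
      (bisim_nil_of_depth_eq_zero (h.weaklyBounded hy) (by omega))
    exact ⟨Q, P, _, this ▸ hy, hP, r⟩
  · obtain ⟨P, Q, n, hP, hQ, r⟩ := hxy
    obtain ⟨S, hS⟩ := h.exists_rep z
    exact ⟨_, _, n, h.par hP hS, h.par hQ hS, r.parL S⟩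
  · obtain ⟨Q, hQ⟩ := h.exists_rep y
    obtain ⟨S, hS⟩ := h.exists_rep z
    obtain ⟨X, n, hX, r⟩ := h.exists_visRun hx (h.par hQ hS)
    obtain ⟨i, j, Q', S', r1, r2, -, rfl⟩ := r.eq_par rfl
    obtain ⟨y', hy'⟩ := h.exists_class_of_visRun hQ r1
    obtain ⟨z', hz'⟩ := h.exists_class_of_visRun hS r2
    exact ⟨y', z', ⟨_, _, _, hy', hQ, r1⟩, ⟨_, _, _, hz', hS, r2⟩,
      h.unique hX (h.par hy' hz')⟩
  -- Each element has finitely many elements below it, and their number drops strictly along `<`.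
  · refine Subrelation.wf ?_ (measure fun y : M => {x : M | x ≤ y}.ncard).wf
    intro x y hxy
    refine Set.ncard_lt_ncard ?_ (h.finite_below y)
    exact ⟨fun z (hz : z ≤ x) => hz.trans hxy.le, fun hs => hxy.not_ge (hs (le_refl y))⟩
  · obtain ⟨P, hP⟩ := h.exists_rep x
    obtain ⟨Q, hQ⟩ := h.exists_rep y
    rw [h.size_eq hP, h.size_eq hQ, h.size_eq (h.par hP hQ),
      depth_par (h.weaklyBounded hP) (h.weaklyBounded hQ)]
  · obtain ⟨P, hP⟩ := h.exists_rep x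
    rw [h.size_eq hP] at hx
    exact (h.eq_iff hP h.nil).2 (bisim_nil_of_depth_eq_zero (h.weaklyBounded hP) hx)

/-! ### Power cancellation -/

/-- A visible action would lower the depth, which depends only on the class. -/
theorem eq_tau_of_optStep (h : IsClassMonoid b Rep) {P Q : Proc Act} {x : M} {α : Label Act}
    (hP : Rep P x) (hQ : Rep Q x) (s : OptStep P α Q) : α = Label.tau := by
  obtain ⟨n, r, hn⟩ := s.exists_visRun
  have := (h.weaklyBounded hP).add_depth_le r
  rw [← h.size_eq hP, ← h.size_eq hQ] at this
  exact hn (by omega)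

theorem exists_class_of_move (h : IsClassMonoid b Rep) {P P₁ P₂ P₃ : Proc Act} {x : M}
    {α : Label Act} (hP : Rep P x) (hm : Move α P P₁ P₂ P₃) :
    letI := h.order
    ∃ x₁ x₂ x₃, Rep P₁ x₁ ∧ Rep P₂ x₂ ∧ Rep P₃ x₃ ∧ x₁ ≤ x ∧ x₂ ≤ x₁ ∧ x₃ ≤ x₂ := by
  obtain ⟨n, r, -⟩ := hm.step.exists_visRun
  obtain ⟨x₁, h1⟩ := h.exists_class_of_visRun hP hm.before.visRun
  obtain ⟨x₂, h2⟩ := h.exists_class_of_visRun h1 r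
  obtain ⟨x₃, h3⟩ := h.exists_class_of_visRun h2 hm.after.visRun
  exact ⟨x₁, x₂, x₃, h1, h2, h3, ⟨_, _, _, h1, hP, hm.before.visRun⟩, ⟨_, _, _, h2, h1, r⟩,
    ⟨_, _, _, h3, h2, hm.after.visRun⟩⟩

/-- The parallel composition of `n` copies of `A` and `V`. -/
def parPow (A V : Proc Act) : ℕ → Proc Act
  | 0 => V
  | n + 1 => Proc.par A (parPow A V n)

theorem rep_parPow (h : IsClassMonoid b Rep) {A V : Proc Act} {p v : M} (hA : Rep A p)
    (hV : Rep V v) (n : ℕ) : Rep (parPow A V n) (p ^ n * v) := by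
  induction n with
  | zero => simpa [parPow] using hV
  | succ n ih =>
    rw [pow_succ', mul_assoc]
    exact h.par hA ih

theorem step_parPow {A V V' : Proc Act} {α : Label Act} (s : Step V α V') (n : ℕ) :
    Step (parPow A V n) α (parPow A V' n) := by
  induction n with
  | zero => exact s
  | succ n ih => exact .parR A ih

/-- A move of `n` copies of `A` and `V` that keeps `n` factors `p` can be ascribed to `V`. -/
theorem exists_move_of_parPow (h : IsClassMonoid b Rep) {A V : Proc Act} {p v : M}
    (hp : Indecomposable p) (hA : Rep A p) (hV : Rep V v) (hAV : A = V ∨ ¬ Below Rep p v)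
    (n : ℕ) : ∀ (α : Label Act) (T₁ T₂ T₃ : Proc Act) (w : M), Move α (parPow A V n) T₁ T₂ T₃ →
      Rep T₃ (p ^ n * w) → UniquelyDecomposable (p ^ n * w) →
      ∃ V₁ V₂ V₃ v₁ v₂ v₃, Move α V V₁ V₂ V₃ ∧ Rep V₁ v₁ ∧ Rep V₂ v₂ ∧ Rep V₃ v₃ ∧
        Rep T₁ (p ^ n * v₁) ∧ Rep T₂ (p ^ n * v₂) ∧ Rep T₃ (p ^ n * v₃) := by
  classical
  let := h.order
  have hO := h.isWeakDecompositionOrder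
  induction n with
  | zero =>
    intro α T₁ T₂ T₃ w hm _ _
    obtain ⟨v₁, v₂, v₃, h1, h2, h3, -⟩ := h.exists_class_of_move hV hm
    simp only [pow_zero, one_mul]
    exact ⟨T₁, T₂, T₃, v₁, v₂, v₃, hm, h1, h2, h3, h1, h2, h3⟩
  | succ n ih =>
    intro α T₁ T₂ T₃ w hm hT hu
    obtain ⟨A₁, A₂, A₃, W₁, W₂, W₃, rfl, rfl, rfl, hs⟩ := Move.eq_par hm
    have hW := h.rep_parPow hA hV n
    obtain ⟨a₁, a₂, a₃, ha₁, ha₂, ha₃, l1, l2, l3⟩ :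
        ∃ x₁ x₂ x₃, Rep A₁ x₁ ∧ Rep A₂ x₂ ∧ Rep A₃ x₃ ∧ x₁ ≤ p ∧ x₂ ≤ x₁ ∧ x₃ ≤ x₂ :=
      hs.elim (fun k => h.exists_class_of_move hA k.1) fun k => h.exists_class_of_move hA k.1
    obtain ⟨w₁, w₂, w₃, hw₁, hw₂, hw₃, m1, m2, m3⟩ :
        ∃ x₁ x₂ x₃, Rep W₁ x₁ ∧ Rep W₂ x₂ ∧ Rep W₃ x₃ ∧ x₁ ≤ p ^ n * v ∧ x₂ ≤ x₁ ∧ x₃ ≤ x₂ :=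
      hs.elim (fun k => h.exists_class_of_move hW k.2) fun k => h.exists_class_of_move hW k.2
    have heq : p ^ (n + 1) * w = a₃ * w₃ := h.unique hT (h.par ha₃ hw₃)
    -- If the first copy ends in class `p`, antisymmetry keeps it there throughout; its share is
    -- then silent and can be dropped.
    by_cases hap : a₃ = p
    · subst hap
      obtain rfl := le_antisymm l1 (l3.trans l2)
      obtain rfl := le_antisymm l2 l3
      have hm' : Move α (parPow A V n) W₁ W₂ W₃ := by
        rcases hs with ⟨k1, k2⟩ | ⟨-, k2⟩
        · rwa [h.eq_tau_of_optStep ha₁ ha₂ k1.step]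
        · exact k2
      rw [pow_succ', mul_assoc] at heq hu
      have hwe := hO.mul_left_cancel_of_unique hu heq
      obtain ⟨V₁, V₂, V₃, v₁, v₂, v₃, h0, h1, h2, h3, h4, h5, h6⟩ :=
        ih α W₁ W₂ W₃ w hm' (hwe ▸ hw₃) (hO.uniquelyDecomposable_right hu)
      refine ⟨V₁, V₂, V₃, v₁, v₂, v₃, h0, h1, h2, h3, ?_⟩
      rw [pow_succ', mul_assoc, mul_assoc, mul_assoc]
      exact ⟨h.par ha₁ h4, h.par ha₂ h5, h.par ha₃ h6⟩
    -- Otherwise `a₃` lies strictly below `p` and has no factor `p`, so `w₃` alone must supply all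
    -- `n + 1` copies.
    · obtain ⟨da, hda⟩ := hO.exists_decomposition a₃
      obtain ⟨dw, hdw⟩ := hO.exists_decomposition w₃
      obtain ⟨du, hdu⟩ := hO.exists_decomposition w
      have hd := hu _ _ ((hp.isDecompositionOf_replicate (n + 1)).mul hdu)
        (heq ▸ hda.mul hdw)
      have hc := congrArg (Multiset.count p) hd
      have hz : da.count p = 0 := Multiset.count_eq_zero.2 fun hmem =>
        hap (le_antisymm ((l3.trans l2).trans l1) (hO.le_of_mem hda hmem))
      rw [Multiset.count_add, Multiset.count_add, Multiset.count_replicate_self, hz] at hc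
      have huw : UniquelyDecomposable w₃ := hO.uniquelyDecomposable_right (heq ▸ hu)
      have hlw := (m3.trans m2).trans m1
      rcases hAV with rfl | hpv
      -- When `V` is itself a copy of `p`, the rest attains the bound `n + 1` and so never leaves `p
      -- ^ (n + 1)`. The first copy made the move and exchanges roles with `V`.
      · obtain rfl := h.unique hA hV
        rw [← pow_succ] at m1 hlw
        obtain ⟨c1, c2⟩ := hO.count_le hp (hO.not_le_one hp) (n + 1) huw
          (by rwa [mul_one]) hdw
        obtain ⟨v', hv', hw₃e⟩ := c2 (by omega)
        obtain rfl := le_antisymm hv' (hO.one_le v')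
        rw [mul_one] at hw₃e
        subst hw₃e
        obtain rfl := le_antisymm m1 (m3.trans m2)
        obtain rfl := le_antisymm m2 m3
        have hm' : Move α A A₁ A₂ A₃ := by
          rcases hs with ⟨k1, -⟩ | ⟨k1, k2⟩
          · exact k1
          · rwa [h.eq_tau_of_optStep hw₁ hw₂ k2.step]
        refine ⟨A₁, A₂, A₃, a₁, a₂, a₃, hm', ha₁, ha₂, ha₃, ?_⟩
        rw [mul_comm _ a₁, mul_comm _ a₂, mul_comm _ a₃]
        exact ⟨h.par ha₁ hw₁, h.par ha₂ hw₂, h.par ha₃ hw₃⟩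
      -- If `p` is not below `v`, at most `n` copies are available in `w₃`: a contradiction.
      · have := (hO.count_le hp hpv n huw hlw hdw).1
        omega

theorem powerCancellation (h : IsClassMonoid b Rep) :
    letI := h.order
    PowerCancellation M := by
  let := h.order
  have hO := h.isWeakDecompositionOrder
  intro p k x y hp hu hxy hx hy
  let Good : M → Prop := fun z => z = p ∨ ¬ p ≤ z
  have good_of_le : ∀ {z z'}, Good z → z' ≤ z → Good z' := by
    rintro z z' (rfl | hz) hl
    · by_cases hp' : z ≤ z'
      · exact Or.inl (le_antisymm hl hp')
      · exact Or.inr hp'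
    · exact Or.inr fun hp' => hz (hp'.trans hl)
  let R : Proc Act → Proc Act → Prop := fun U V => ∃ r s, Rep U r ∧ Rep V s ∧
    (r = s ∨ (p ^ k * r = p ^ k * x ∧ p ^ k * s = p ^ k * x ∧ Good r ∧ Good s))
  have hR : IsBisim b R := by
    refine ⟨?_, ?_⟩
    · rintro U V ⟨r, s, hr, hs, rfl | ⟨h1, h2, h3, h4⟩⟩
      · exact ⟨r, r, hs, hr, Or.inl rfl⟩
      · exact ⟨s, r, hs, hr, Or.inr ⟨h2, h1, h4, h3⟩⟩
    · rintro U V ⟨r, s, hr, hs, hrs⟩ α U' st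
      obtain ⟨n, run, hn⟩ := st.exists_visRun
      obtain ⟨r', hr'⟩ := h.exists_class_of_visRun hr run
      rcases hrs with rfl | ⟨h1, h2, h3, h4⟩
      · obtain ⟨V₁, V₂, V₃, hm, k1, k2⟩ :=
          isBisim_bisim.2 _ _ ((h.eq_iff hr hs).1 rfl) _ _ st
        obtain ⟨v₁, v₂, v₃, hv₁, hv₂, hv₃, -⟩ := h.exists_class_of_move hs hm
        exact ⟨V₁, V₂, V₃, hm, ⟨r', v₃, hr', hv₃, Or.inl ((h.eq_iff hr' hv₃).2 k1)⟩,
          fun hb => ⟨⟨r, v₁, hr, hv₁, Or.inl ((h.eq_iff hr hv₁).2 (k2 hb).1)⟩,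
            ⟨r', v₂, hr', hv₂, Or.inl ((h.eq_iff hr' hv₂).2 (k2 hb).2)⟩⟩⟩
      · have hle : r' ≤ r := ⟨_, _, _, hr', hr, run⟩
        -- If the product class is kept, size forces a silent step, and `V` idles.
        by_cases he : p ^ k * r' = p ^ k * x
        · have hα : α = Label.tau := by
            refine hn ?_
            have e1 := (h.weaklyBounded hr).add_depth_le run
            have e2 := congrArg h.size (he.trans h1.symm)
            rw [hO.size_mul, hO.size_mul, h.size_eq hr, h.size_eq hr'] at e2
            omega
          have hR' : R U' V := ⟨r', s, hr', hs, Or.inr ⟨he, h2, good_of_le h3 hle, h4⟩⟩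
          exact ⟨V, V, V, ⟨Relation.ReflTransGen.refl, Or.inr ⟨hα, rfl⟩,
            Relation.ReflTransGen.refl⟩, hR',
            fun _ => ⟨⟨r, s, hr, hs, Or.inr ⟨h1, h2, h3, h4⟩⟩, hR'⟩⟩
        · obtain ⟨A, hA, hAV⟩ : ∃ A, Rep A p ∧ (A = V ∨ ¬ Below Rep p s) := by
            rcases h4 with rfl | h4
            · exact ⟨V, hs, Or.inl rfl⟩
            · obtain ⟨A, hA⟩ := h.exists_rep p
              exact ⟨A, hA, Or.inr h4⟩
          have hU := h.rep_parPow hA hr k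
          have hU' := h.rep_parPow hA hr' k
          have hV := h.rep_parPow hA hs k
          have hlt : p ^ k * r' < p ^ k * x := by
            refine lt_of_le_of_ne ?_ he
            rw [← h1, mul_comm _ r', mul_comm _ r]
            exact hO.mul_le _ hle
          have hud := hu _ hlt
          obtain ⟨T₁, T₂, T₃, hm, k1, k2⟩ :=
            isBisim_bisim.2 _ _ ((h.eq_iff hU hV).1 (h1.trans h2.symm)) _ _ (step_parPow st k)
          obtain ⟨t₁, t₂, t₃, ht₁, ht₂, ht₃, -⟩ := h.exists_class_of_move hV hm
          obtain rfl := (h.eq_iff hU' ht₃).2 k1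
          obtain ⟨V₁, V₂, V₃, v₁, v₂, v₃, hmv, hv₁, hv₂, hv₃, g1, g2, g3⟩ :=
            h.exists_move_of_parPow hp hA hs hAV k α T₁ T₂ T₃ r' hm ht₃ hud
          obtain ⟨_, _, _, q1, -, -, l1, -⟩ := h.exists_class_of_move hs hmv
          obtain rfl := h.unique q1 hv₁
          refine ⟨V₁, V₂, V₃, hmv, ⟨r', v₃, hr', hv₃, Or.inl ?_⟩, fun hb =>
            ⟨⟨r, _, hr, hv₁, Or.inr ⟨h1, ?_, h3, good_of_le h4 l1⟩⟩,
              ⟨r', v₂, hr', hv₂, Or.inl ?_⟩⟩⟩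
          -- The targets lie in the uniquely decomposable class `p ^ k * r'`, so `p ^ k` cancels.
          -- The intermediate state before the action need not lie there and stays in the second
          -- clause of `R`.
          · exact hO.mul_left_cancel_of_unique hud (h.unique ht₃ g3)
          · exact ((h.eq_iff hU g1).2 (k2 hb).1).symm.trans h1
          · exact hO.mul_left_cancel_of_unique hud ((h.eq_iff hU' g2).2 (k2 hb).2)
  obtain ⟨U, hU⟩ := h.exists_rep x
  obtain ⟨V, hV⟩ := h.exists_rep y
  exact (h.eq_iff hU hV).2 ⟨R, hR, x, y, hU, hV, Or.inr ⟨rfl, hxy.symm, hx, hy⟩⟩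

theorem hasUniqueDecomposition (h : IsClassMonoid b Rep) : HasUniqueDecomposition M :=
  letI := h.order
  h.isWeakDecompositionOrder.hasUniqueDecomposition h.powerCancellation

end IsClassMonoid

/-! ### The branching and weak class monoids -/

theorem isClassMonoid_bProcFin (Act : Type u) :
    IsClassMonoid True fun (P : Proc Act) (x : BProcFin Act) =>
      WeaklyBounded P ∧ BProc.mk P = x.1 where
  exists_rep x := x.2
  weaklyBounded hP := hP.1
  exists_class {P} hP := ⟨⟨BProc.mk P, P, hP, rfl⟩, hP, rfl⟩
  eq_iff {P Q x y} hP hQ := by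
    rw [bisim_true_iff, Subtype.ext_iff, ← hP.2, ← hQ.2]
    exact Quotient.eq (r := bbisimSetoid Act)
  par hP hQ := ⟨hP.1.par hQ.1, by rw [Submonoid.coe_mul, ← hP.2, ← hQ.2]; rfl⟩
  nil := ⟨weaklyBounded_nil, rfl⟩

theorem isClassMonoid_wProcFin (Act : Type u) :
    IsClassMonoid False fun (P : Proc Act) (x : WProcFin Act) =>
      WeaklyBounded P ∧ WProc.mk P = x.1 where
  exists_rep x := x.2
  weaklyBounded hP := hP.1
  exists_class {P} hP := ⟨⟨WProc.mk P, P, hP, rfl⟩, hP, rfl⟩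
  eq_iff {P Q x y} hP hQ := by
    rw [bisim_false_iff, Subtype.ext_iff, ← hP.2, ← hQ.2]
    exact Quotient.eq (r := wbisimSetoid Act)
  par hP hQ := ⟨hP.1.par hQ.1, by rw [Submonoid.coe_mul, ← hP.2, ← hQ.2]; rfl⟩
  nil := ⟨weaklyBounded_nil, rfl⟩

end BCCS

theorem mainTheorem2 (Act : Type*) :
    BCCS.HasUniqueDecomposition (BCCS.BProcFin Act) ∧
    BCCS.HasUniqueDecomposition (BCCS.WProcFin Act) :=
  ⟨(BCCS.isClassMonoid_bProcFin Act).hasUniqueDecomposition,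
    (BCCS.isClassMonoid_wProcFin Act).hasUniqueDecomposition⟩
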